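/- Let $r\ge 3$ and $\ell\ge 1$ be integers and let $U$ be a finite set with $|U|\ge 2$. In the problem $\mathsf{SetEquality}_{\ell,U}$ on the line graph of length $r$ (the path with nodes $v_0,\dots,v_r$), each node $v_i$ holds two lists $(a_{i,1},\dots,a_{i,\ell})$ and $(b_{i,1},\dots,b_{i,\ell})$ of elements of $U$, and the answer is "yes" if the multisets $A=\{a_{i,j}\}_{0\le i\le r,\,1\le j\le \ell}$ and $B=\{b_{i,j}\}_{0\le i\le r,\,1\le j\le \ell}$ are equal, and "no" otherwise. In a classical distributed Merlin-Arthur (dMA) protocol, a prover sends a certificate (a bit string) to each node; then each node sends one message to each of its neighbours, computed from its input, its certificate and its private randomness (independent between the nodes, with no shared randomness), and finally accepts or rejects on the basis of its input, its certificate, its private randomness and the messages received. The length of the messages is not restricted. The certificate size $s_c$ is the maximum number of bits sent by the prover to a node. The protocol has completeness $3/4$ and soundness $1/4$ if, on every yes-instance, there are certificates for which all nodes accept with probability at least $3/4$, and, on every no-instance, for all certificates all nodes accept with probability at most $1/4$. Every classical dMA protocol for $\mathsf{SetEquality}_{\ell,U}$ on the line graph of length $r$ with completeness $3/4$, soundness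 $1/4$ and certificate size $s_c$ satisfies the following. 1. If $|U|<\ell$, then $s_c=\Omega\bigl(|U|\log(\ell/|U|)\bigr)$: there is an absolute constant $c>0$ with $s_c\ge c\,|U|\log_2(\ell/|U|)$ for all such $r,\ell,U$ and all such protocols. 2. If $|U|=\Omega(\ell)$, then $s_c=\Omega(\ell)$: for every $\kappa>0$ there is $c>0$, depending only on $\kappa$, such that $s_c\ge c\,\ell$ whenever $|U|\ge \kappa\,\ell$. 3. If $|U|=\Omega(r\ell)$, then $s_c=\Omega(r\ell)$: for every $\kappa>0$ there is $c>0$, depending only on $\kappa$, such that $s_c\ge c\,r\ell$ whenever $|U|\ge \kappa\, r\ell$. -/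

import Mathlib

open MeasureTheory

/-- A (one-round, classical) distributed Merlin-Arthur protocol on a network `G` with node set `V`,
for problems in which every node holds an input from `I`.  Node `v` receives a certificate of
`certLen v` bits from the prover, and has a private random source `(Rand v, law v)`, an arbitrary
probability space.  It sends to each neighbour a bit string that depends on its input, its
certificate and its private randomness, and then decides from these and from the messages received
from its neighbours.  There is no bound on the length of the messages. -/
structure DMAProtocol {V : Type*} (G : SimpleGraph V) (I : Type*) where
  /-- number of bits of the certificate of a node -/
  certLen : V → ℕ
  /-- number of bits sent from one node to another -/
  msgLen : V → V → ℕ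
  /-- the sample space of the private randomness of a node -/
  Rand : V → Type
  [measRand : ∀ v, MeasurableSpace (Rand v)]
  /-- the distribution of the private randomness of a node -/
  law : ∀ v, Measure (Rand v)
  [probLaw : ∀ v, IsProbabilityMeasure (law v)]
  /-- the message from `u` to its neighbour `v` -/
  send : ∀ u v, G.Adj u v → I → (Fin (certLen u) → Bool) → Rand u → (Fin (msgLen u v) → Bool)
  /-- the decision of `v` (`true` means accept), given its input, its certificate, its private
  randomness and the messages from all of its neighbours -/
  decision : ∀ v, I → (Fin (certLen v) → Bool) → Rand v →
    (∀ u, G.Adj u v → (Fin (msgLen u v) → Bool)) → Bool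
  measurable_send : ∀ u v (h : G.Adj u v) (x : I) (c : Fin (certLen u) → Bool),
    Measurable (send u v h x c)
  measurable_decision : ∀ v (x : I) (c : Fin (certLen v) → Bool)
    (m : ∀ u, G.Adj u v → (Fin (msgLen u v) → Bool)),
    Measurable (fun ω => decision v x c ω m)

namespace DMAProtocol

attribute [instance] DMAProtocol.measRand DMAProtocol.probLaw

variable {V : Type*} {G : SimpleGraph V} {I : Type*}

/-- An assignment of certificates to all the nodes. -/
abbrev Certificates (P : DMAProtocol G I) : Type _ := ∀ v, Fin (P.certLen v) → Bool

/-- Node `v` accepts on inputs `x`, certificates `c` and outcomes `ω` of the private randomness. -/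
def NodeAccepts (P : DMAProtocol G I) (x : V → I) (c : P.Certificates) (ω : ∀ v, P.Rand v)
    (v : V) : Prop :=
  P.decision v (x v) (c v) (ω v) (fun u h => P.send u v h (x u) (c u) (ω u)) = true

/-- The probability that all nodes accept.  The random sources of the nodes are independent. -/
noncomputable def acceptProb [Fintype V] (P : DMAProtocol G I) (x : V → I)
    (c : P.Certificates) : ℝ :=
  (Measure.pi P.law).real {ω | ∀ v, P.NodeAccepts x c ω v}

/-- The certificate size: the maximum number of bits that the prover sends to a node. -/
def certSize [Fintype V] (P : DMAProtocol G I) : ℕ :=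
  Finset.univ.sup P.certLen

/-- `P` is a protocol for the decision problem `f` with completeness `pc` and soundness `ps`. -/
def Solves [Fintype V] (P : DMAProtocol G I) (f : (V → I) → Prop) (pc ps : ℝ) : Prop :=
  (∀ x, f x → ∃ c : P.Certificates, pc ≤ P.acceptProb x c) ∧
  (∀ x, ¬ f x → ∀ c : P.Certificates, P.acceptProb x c ≤ ps)

end DMAProtocol

/-- The input of one node in the set equality problem: two lists of `ℓ` elements of `U`. -/
abbrev SetEqInput (ℓ : ℕ) (U : Type*) : Type _ := (Fin ℓ → U) × (Fin ℓ → U)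

/-- The set equality problem: the multiset `A` of all entries of the first lists, over all the
nodes, equals the multiset `B` of all entries of the second lists. -/
def SetEquality {V : Type*} [Fintype V] (ℓ : ℕ) (U : Type*) (x : V → SetEqInput ℓ U) : Prop :=
  (Finset.univ : Finset (V × Fin ℓ)).val.map (fun p => (x p.1).1 p.2) =
    (Finset.univ : Finset (V × Fin ℓ)).val.map (fun p => (x p.1).2 p.2)

/-- The line graph of length `r`, with nodes `0, …, r` and edges between consecutive nodes. -/
abbrev lineGraph (r : ℕ) : SimpleGraph (Fin (r + 1)) := SimpleGraph.pathGraph (r + 1)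

/-- A classical dMA protocol for set equality on the line of length `r`, before any requirement
of correctness. -/
abbrev SetEqProtocol (r ℓ : ℕ) (U : Type*) : Type _ := DMAProtocol (lineGraph r) (SetEqInput ℓ U)

/-! ### Crossing two accepted instances at an edge of the path -/

namespace DMAProtocol

variable {V : Type*} {G : SimpleGraph V} {I : Type*}

/-! The proof is a fooling set argument at one edge. Suppose two yes-instances have accepted
certificates that agree on both ends of the edge. Gluing the left part of one to the right part of
the other leaves every node a view from one of the originals, so a union bound gives acceptance
probability at least 1/2, and the glued instance cannot be a no-instance (`Solves.cut`). Distinct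
members of a fooling set thus differ in the certificates of two nodes, at most `2 * certSize` bits.
For set equality, the fooling set consists of the multisets of size `k * ℓ` over `U`, written in the
first lists of `k` nodes on the left and in the second lists of `k` nodes on the right, with a
constant elsewhere. Lower bounds on the number of multisets then give all three claims, with `k = 1`
for the first two and `k` about `r / 2` for the third. -/

theorem measurableSet_nodeAccepts [Fintype V] (P : DMAProtocol G I) (x : V → I)
    (c : P.Certificates) (v : V) : MeasurableSet {ω | P.NodeAccepts x c ω v} := by
  have h : {ω | P.NodeAccepts x c ω v} =
      ⋃ m : ∀ u, G.Adj u v → (Fin (P.msgLen u v) → Bool),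
        ({ω : ∀ v, P.Rand v | P.decision v (x v) (c v) (ω v) m = true} ∩
          ⋂ u, ⋂ h : G.Adj u v, {ω | P.send u v h (x u) (c u) (ω u) = m u h}) := by
    ext ω
    simp only [Set.mem_ofPred_eq, Set.mem_iUnion, Set.mem_inter_iff, Set.mem_iInter, NodeAccepts]
    constructor
    · intro h
      exact ⟨_, h, fun _ _ => rfl⟩
    · rintro ⟨m, h, hm⟩
      have : m = fun u h => P.send u v h (x u) (c u) (ω u) := by
        funext u h
        exact (hm u h).symm
      rwa [this] at h
  rw [h]
  refine MeasurableSet.iUnion fun m => MeasurableSet.inter ?_ ?_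
  · exact ((P.measurable_decision v (x v) (c v) m).comp (measurable_pi_apply v))
      (measurableSet_singleton true)
  · refine MeasurableSet.iInter fun u => MeasurableSet.iInter fun h => ?_
    exact ((P.measurable_send u v h (x u) (c u)).comp (measurable_pi_apply u))
      (measurableSet_singleton (m u h))

theorem nodeAccepts_congr (P : DMAProtocol G I) {x y : V → I} {c d : P.Certificates} {v : V}
    (hv : x v = y v ∧ c v = d v) (hadj : ∀ u, G.Adj u v → x u = y u ∧ c u = d u)
    (ω : ∀ v, P.Rand v) : P.NodeAccepts x c ω v ↔ P.NodeAccepts y d ω v := by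
  unfold NodeAccepts
  have : (fun u h => P.send u v h (x u) (c u) (ω u)) =
      fun u h => P.send u v h (y u) (d u) (ω u) := by
    funext u h
    rw [(hadj u h).1, (hadj u h).2]
  rw [this, hv.1, hv.2]

/-- If every node sees, in its closed neighbourhood, either `(y, d)` or `(z, e)`, then `(x, c)` is
accepted with probability at least the sum of the other two minus one. -/
theorem acceptProb_hybrid [Fintype V] (P : DMAProtocol G I) {x y z : V → I}
    {c d e : P.Certificates}
    (h : ∀ v, ((x v = y v ∧ c v = d v) ∧ ∀ u, G.Adj u v → x u = y u ∧ c u = d u) ∨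
      ((x v = z v ∧ c v = e v) ∧ ∀ u, G.Adj u v → x u = z u ∧ c u = e u)) :
    P.acceptProb y d + P.acceptProb z e - 1 ≤ P.acceptProb x c := by
  unfold acceptProb
  set μ := Measure.pi P.law
  have hm : MeasurableSet {ω | ∀ v, P.NodeAccepts z e ω v} := by
    rw [Set.ofPred_forall]
    exact MeasurableSet.iInter fun v => P.measurableSet_nodeAccepts z e v
  have h1 := measureReal_union_add_inter (μ := μ)
    (s := {ω | ∀ v, P.NodeAccepts y d ω v}) hm
  have h2 : μ.real ({ω | ∀ v, P.NodeAccepts y d ω v} ∪ {ω | ∀ v, P.NodeAccepts z e ω v}) ≤ 1 :=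
    measureReal_le_one
  have h3 : μ.real ({ω | ∀ v, P.NodeAccepts y d ω v} ∩ {ω | ∀ v, P.NodeAccepts z e ω v}) ≤
      μ.real {ω | ∀ v, P.NodeAccepts x c ω v} := by
    refine measureReal_mono ?_
    rintro ω ⟨hy, hz⟩ v
    rcases h v with ⟨hv, hu⟩ | ⟨hv, hu⟩
    · exact (P.nodeAccepts_congr hv hu ω).2 (hy v)
    · exact (P.nodeAccepts_congr hv hu ω).2 (hz v)
  linarith

/-- A protocol cannot solve `f` when two yes-instances have accepted certificates that agree on both
ends of an edge of the path, and crossing the instances at this edge gives a no-instance. -/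
theorem Solves.cut {r : ℕ} {P : DMAProtocol (lineGraph r) I} {f : (Fin (r + 1) → I) → Prop}
    (hP : P.Solves f (3 / 4) (1 / 4)) {x y z : Fin (r + 1) → I} (k : ℕ)
    {d e : P.Certificates} (hd : 3 / 4 ≤ P.acceptProb y d) (he : 3 / 4 ≤ P.acceptProb z e)
    (hy : ∀ v, v.val ≤ k + 1 → x v = y v) (hz : ∀ v, k ≤ v.val → x v = z v)
    (hde : ∀ v : Fin (r + 1), v.val = k ∨ v.val = k + 1 → d v = e v) : f x := by
  by_contra hx
  -- Agreement at `k` and `k + 1` makes `c` equal to `d` up to `k + 1` and to `e` from `k` on, which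
  -- covers every closed neighbourhood.
  let c : P.Certificates := fun v => if v.val ≤ k then d v else e v
  have hcd : ∀ v, v.val ≤ k + 1 → c v = d v := by
    intro v hv
    by_cases h : v.val ≤ k
    · simp [c, h]
    · simp [c, h, hde v (by omega)]
  have hce : ∀ v, k ≤ v.val → c v = e v := by
    intro v hv
    by_cases h : v.val ≤ k
    · simp [c, h, hde v (by omega)]
    · simp [c, h]
  have h1 := hP.2 x hx c
  have h2 : P.acceptProb y d + P.acceptProb z e - 1 ≤ P.acceptProb x c := by
    refine P.acceptProb_hybrid fun v => ?_
    rcases le_or_gt v.val k with h | h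
    · refine Or.inl ⟨⟨hy v (by omega), hcd v (by omega)⟩, fun u hu => ?_⟩
      have : u.val ≤ k + 1 := by
        rw [SimpleGraph.pathGraph_adj] at hu
        omega
      exact ⟨hy u this, hcd u this⟩
    · refine Or.inr ⟨⟨hz v (by omega), hce v (by omega)⟩, fun u hu => ?_⟩
      have : k ≤ u.val := by
        rw [SimpleGraph.pathGraph_adj] at hu
        omega
      exact ⟨hz u this, hce u this⟩
  -- 3/4 + 3/4 - 1 = 1/2 exceeds the soundness bound 1/4.
  linarith

/-- The fooling set bound on the path: a family of pairwise crossing instances `x s t` that are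
yes-instances only on the diagonal has at most `2 ^ (2 * certSize)` indices. -/
theorem Solves.card_le_of_foolingSet {r : ℕ} {P : DMAProtocol (lineGraph r) I}
    {f : (Fin (r + 1) → I) → Prop} (hP : P.Solves f (3 / 4) (1 / 4)) {S : Type*} [Fintype S]
    (x : S → S → Fin (r + 1) → I) (hf : ∀ s t, f (x s t) ↔ s = t) (k : ℕ) (hk : k + 1 < r + 1)
    (hl : ∀ s t v, v.val ≤ k + 1 → x s t v = x s s v)
    (hr : ∀ s t v, k ≤ v.val → x s t v = x t t v) :
    Fintype.card S ≤ 2 ^ (2 * P.certSize) := by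
  choose c hc using fun s => hP.1 (x s s) ((hf s s).2 rfl)
  let a : Fin (r + 1) := ⟨k, by omega⟩
  let b : Fin (r + 1) := ⟨k + 1, hk⟩
  have hinj : Function.Injective fun s => (c s a, c s b) := by
    intro s t hst
    rw [Prod.mk.injEq] at hst
    refine (hf s t).1 (hP.cut k (hc s) (hc t) (hl s t) (hr s t) fun v hv => ?_)
    rcases hv with hv | hv
    · obtain rfl : v = a := Fin.ext hv
      exact hst.1
    · obtain rfl : v = b := Fin.ext hv
      exact hst.2
  have h := Fintype.card_le_of_injective _ hinj
  simp only [Fintype.card_prod, Fintype.card_fun, Fintype.card_bool, Fintype.card_fin,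
    ← pow_add] at h
  refine h.trans (Nat.pow_le_pow_right (by norm_num) ?_)
  have ha : P.certLen a ≤ P.certSize := Finset.le_sup (f := P.certLen) (Finset.mem_univ a)
  have hb : P.certLen b ≤ P.certSize := Finset.le_sup (f := P.certLen) (Finset.mem_univ b)
  omega

end DMAProtocol

/-! ### Multisets as padded lists -/

/-- The padding does not depend on `g`, so it cancels when two padded lists are compared. -/
theorem Multiset.map_univ_extend {α β U : Type*} [Fintype α] [Fintype β] (φ : α ↪ β) (g : α → U)
    (u : U) :
    (Finset.univ : Finset β).val.map (Function.extend φ g fun _ => u) =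
      (Finset.univ : Finset α).val.map g +
        Multiset.replicate (Fintype.card β - Fintype.card α) u := by
  classical
  have hu : (Finset.univ : Finset β) = (Finset.univ.map φ).disjUnion (Finset.univ.map φ)ᶜ
      disjoint_compl_right := by
    rw [Finset.disjUnion_eq_union, Finset.union_compl]
  rw [hu, Finset.disjUnion_val, Multiset.map_add, Finset.map_val, Multiset.map_map]
  congr 1
  · exact Multiset.map_congr rfl fun i _ => φ.injective.extend_apply _ _ i
  · have h : ((Finset.univ.map φ)ᶜ).val.map (Function.extend φ g fun _ => u) =
        ((Finset.univ.map φ)ᶜ).val.map fun _ => u := by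
      refine Multiset.map_congr rfl fun b hb => Function.extend_apply' _ _ _ ?_
      rintro ⟨i, rfl⟩
      simp at hb
    rw [h, Multiset.map_const', Finset.card_val, Finset.card_compl, Finset.card_map,
      Finset.card_univ]

theorem Sym.exists_map_univ_eq {α U : Type*} [Fintype α] {n : ℕ} (hn : Fintype.card α = n)
    (s : Sym U n) : ∃ g : α → U, (Finset.univ : Finset α).val.map g = s.val := by
  subst hn
  obtain ⟨s, hs⟩ := s
  induction s using Quotient.inductionOn with
  | h l =>
    have hl : l.length = Fintype.card α := by simpa using hs
    let e : α ≃ Fin l.length := (Fintype.equivFin α).trans (finCongr hl.symm)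
    refine ⟨fun i => l.get (e i), ?_⟩
    have h : (Finset.univ : Finset α).val.map e = (Finset.univ : Finset (Fin l.length)).val := by
      simp
    change Multiset.map (l.get ∘ e) _ = _
    rw [← Multiset.map_map, h, Fin.univ_val_map, List.ofFn_get]
    rfl

/-! ### The fooling set for set equality -/

namespace SetEqProtocol

/-- The nodes `i, …, i + k - 1` of the path of length `r`. -/
def block (r k i : ℕ) (h : i + k ≤ r + 1) : Fin k ↪ Fin (r + 1) where
  toFun v := ⟨i + v.val, by omega⟩
  inj' v w hvw := by
    rw [Fin.mk.injEq] at hvw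
    exact Fin.ext (by omega)

/-- Lists for all nodes, equal to `g` on a block of nodes and constant on the others. -/
noncomputable def blockLists {U : Type*} (r ℓ k i : ℕ) (h : i + k ≤ r + 1) (u : U)
    (g : Fin k × Fin ℓ → U) : Fin (r + 1) × Fin ℓ → U :=
  Function.extend ((block r k i h).prodMap (Function.Embedding.refl (Fin ℓ))) g fun _ => u

theorem blockLists_of_notMem {U : Type*} {r ℓ k i : ℕ} (h : i + k ≤ r + 1) (u : U)
    (g : Fin k × Fin ℓ → U) {v : Fin (r + 1)} (hv : v.val < i ∨ i + k ≤ v.val) (j : Fin ℓ) :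
    blockLists r ℓ k i h u g (v, j) = u := by
  refine Function.extend_apply' _ _ _ ?_
  rintro ⟨⟨w, j'⟩, hw⟩
  have : i + w.val = v.val := congrArg (fun p => p.1.val) hw
  omega

theorem choose_le {r ℓ : ℕ} {U : Type*} [Fintype U] (P : SetEqProtocol r ℓ U)
    (hU : 1 ≤ Fintype.card U) (hP : P.Solves (SetEquality ℓ U) (3 / 4) (1 / 4)) {k : ℕ}
    (hk : 2 * k + 1 ≤ r) :
    (k * ℓ + (Fintype.card U - 1)).choose (k * ℓ) ≤ 2 ^ (2 * P.certSize) := by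
  classical
  obtain ⟨u⟩ : Nonempty U := Fintype.card_pos_iff.1 hU
  have hcard : Fintype.card (Fin k × Fin ℓ) = k * ℓ := by simp
  choose g hg using fun s : Sym U (k * ℓ) => Sym.exists_map_univ_eq hcard s
  have h0 : 0 + k ≤ r + 1 := by omega
  -- Starting the right block at `k + 2` keeps the lists of nodes `k` and `k + 1` constant, as the
  -- crossing requires.
  have h2 : k + 2 + k ≤ r + 1 := by omega
  have h := hP.card_le_of_foolingSet (S := Sym U (k * ℓ))
    (fun s t v => (fun j => blockLists r ℓ k 0 h0 u (g s) (v, j),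
      fun j => blockLists r ℓ k (k + 2) h2 u (g t) (v, j))) ?_ k (by omega) ?_ ?_
  · rw [Sym.card_sym_eq_choose] at h
    rwa [show k * ℓ + (Fintype.card U - 1) = Fintype.card U + k * ℓ - 1 by omega]
  · intro s t
    unfold SetEquality
    change Multiset.map (blockLists r ℓ k 0 h0 u (g s)) _ =
      Multiset.map (blockLists r ℓ k (k + 2) h2 u (g t)) _ ↔ _
    rw [blockLists, blockLists, Multiset.map_univ_extend, Multiset.map_univ_extend,
      add_left_inj, hg, hg]
    exact Subtype.val_injective.eq_iff
  · intro s t v hv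
    refine Prod.ext rfl (funext fun j => ?_)
    simp only
    rw [blockLists_of_notMem h2 u _ (by omega), blockLists_of_notMem h2 u _ (by omega)]
  · intro s t v hv
    refine Prod.ext (funext fun j => ?_) rfl
    simp only
    rw [blockLists_of_notMem h0 u _ (by omega), blockLists_of_notMem h0 u _ (by omega)]

end SetEqProtocol

/-! ### Lower bounds on binomial coefficients -/

/-- The coefficient is the product of `(n + i) / i` over `1 ≤ i ≤ j`, and each factor is at least
`(n + m) / m` since `i ≤ m`. Separating `j` from `m` fixes the base during the induction. -/
theorem Nat.add_div_pow_le_choose {n m j : ℕ} (hj : j ≤ m) :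
    (((n : ℝ) + m) / m) ^ j ≤ ((n + j).choose j : ℝ) := by
  induction j with
  | zero => simp
  | succ j ih =>
    have hm : (0 : ℝ) < m := by exact_mod_cast (show 0 < m by omega)
    have hrec : ((n + (j + 1)).choose (j + 1) : ℝ) =
        ((n + j).choose j : ℝ) * (((n : ℝ) + (j + 1)) / (j + 1)) := by
      have := Nat.add_one_mul_choose_eq (n + j) j
      have h' : ((n : ℝ) + j + 1) * ((n + j).choose j : ℝ) =
          ((n + (j + 1)).choose (j + 1) : ℝ) * (j + 1) := by exact_mod_cast this
      field_simp
      linarith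
    rw [hrec, pow_succ]
    have hjm : (j : ℝ) + 1 ≤ m := by exact_mod_cast hj
    have hstep : ((n : ℝ) + m) / m ≤ ((n : ℝ) + (j + 1)) / (j + 1) := by
      rw [div_le_div_iff₀ hm (by positivity)]
      nlinarith [mul_le_mul_of_nonneg_left hjm (Nat.cast_nonneg (α := ℝ) n)]
    exact mul_le_mul (ih (by omega)) hstep (by positivity) (by positivity)

theorem Nat.two_pow_min_le_choose (n m : ℕ) : 2 ^ min n m ≤ (n + m).choose n := by
  have key : ∀ a b : ℕ, b ≤ a → 2 ^ b ≤ (a + b).choose b := by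
    intro a b hab
    rcases Nat.eq_zero_or_pos b with rfl | hb
    · simp
    have hb' : (0 : ℝ) < b := by exact_mod_cast hb
    have h := Nat.add_div_pow_le_choose (n := a) (le_refl b)
    have h2 : (2 : ℝ) ≤ ((a : ℝ) + b) / b := by
      rw [le_div_iff₀ hb']
      have : (b : ℝ) ≤ a := by exact_mod_cast hab
      linarith
    have h3 := (pow_le_pow_left₀ (by norm_num) h2 b).trans h
    exact_mod_cast h3
  rcases le_total n m with h | h
  · rw [min_eq_left h, Nat.add_comm]
    exact key m n h
  · rw [min_eq_right h, Nat.choose_symm_add]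
    exact key n m h

/-! ### Bounds on the certificate size -/

namespace SetEqProtocol

theorem min_le_two_mul_certSize {r ℓ : ℕ} {U : Type*} [Fintype U] (P : SetEqProtocol r ℓ U)
    (hU : 1 ≤ Fintype.card U) (hP : P.Solves (SetEquality ℓ U) (3 / 4) (1 / 4)) {k : ℕ}
    (hk : 2 * k + 1 ≤ r) : min (k * ℓ) (Fintype.card U - 1) ≤ 2 * P.certSize :=
  (Nat.pow_le_pow_iff_right (by norm_num)).1
    ((Nat.two_pow_min_le_choose _ _).trans (P.choose_le hU hP hk))

/-- `N` stands for `ℓ` or `r * ℓ`. The two constants match the two cases of the minimum; in the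
second, `|U| ≤ 2 * (|U| - 1)` because `|U| ≥ 2`. -/
theorem mul_le_certSize {r ℓ : ℕ} {U : Type*} [Fintype U] (P : SetEqProtocol r ℓ U)
    (hU : 2 ≤ Fintype.card U) (hP : P.Solves (SetEquality ℓ U) (3 / 4) (1 / 4)) {k : ℕ}
    (hk : 2 * k + 1 ≤ r) {N κ : ℝ} (hN : 0 ≤ N) (hNk : N ≤ 4 * (k * ℓ : ℕ))
    (hκ : κ * N ≤ Fintype.card U) : min (1 / 8) (κ / 4) * N ≤ P.certSize := by
  have h := P.min_le_two_mul_certSize (by omega) hP hk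
  rcases min_le_iff.1 h with h | h
  · have h' : ((k * ℓ : ℕ) : ℝ) ≤ 2 * P.certSize := by exact_mod_cast h
    have := mul_le_mul_of_nonneg_right (min_le_left (1 / 8 : ℝ) (κ / 4)) hN
    linarith
  · have h' : (Fintype.card U : ℝ) ≤ 4 * P.certSize := by
      exact_mod_cast (show Fintype.card U ≤ 4 * P.certSize by omega)
    have := mul_le_mul_of_nonneg_right (min_le_right (1 / 8 : ℝ) (κ / 4)) hN
    linarith

theorem card_mul_logb_le_certSize {r ℓ : ℕ} {U : Type*} [Fintype U] (P : SetEqProtocol r ℓ U)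
    (hr : 3 ≤ r) (hU : 2 ≤ Fintype.card U) (hUℓ : Fintype.card U < ℓ)
    (hP : P.Solves (SetEquality ℓ U) (3 / 4) (1 / 4)) :
    (1 / 4 : ℝ) * ((Fintype.card U : ℝ) * Real.logb 2 ((ℓ : ℝ) / (Fintype.card U : ℝ)))
      ≤ (P.certSize : ℝ) := by
  have h := P.choose_le (by omega) hP (k := 1) (by omega)
  obtain ⟨m, hm⟩ : ∃ m, Fintype.card U = m + 1 := ⟨Fintype.card U - 1, by omega⟩
  rw [hm] at hU hUℓ h ⊢
  rw [one_mul, Nat.add_sub_cancel, Nat.choose_symm_add] at h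
  have hm1 : (1 : ℝ) ≤ m := by exact_mod_cast (show 1 ≤ m by omega)
  have hm2 : ((m + 1 : ℕ) : ℝ) < ℓ := by exact_mod_cast hUℓ
  push_cast at hm2 ⊢
  have hratio : (1 : ℝ) ≤ (ℓ : ℝ) / (m + 1) := by
    rw [le_div_iff₀ (by positivity)]
    linarith
  have hle : (ℓ : ℝ) / (m + 1) ≤ ((ℓ : ℝ) + m) / m := by
    rw [div_le_div_iff₀ (by positivity) (by positivity)]
    nlinarith
  have hpow : ((ℓ : ℝ) / (m + 1)) ^ m ≤ 2 ^ (2 * P.certSize) :=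
    (pow_le_pow_left₀ (by positivity) hle m).trans
      ((Nat.add_div_pow_le_choose (le_refl m)).trans (by exact_mod_cast h))
  have hlog := Real.logb_le_logb_of_le (b := 2) (by norm_num) (by positivity) hpow
  rw [Real.logb_pow, Real.logb_pow, Real.logb_self_eq_one (by norm_num), mul_one] at hlog
  push_cast at hlog
  have hnn : 0 ≤ Real.logb 2 ((ℓ : ℝ) / (m + 1)) := Real.logb_nonneg (by norm_num) hratio
  -- The exponent is `m = |U| - 1`; `m + 1 ≤ 2 * m` costs the second factor 2 in 1/4.
  nlinarith [mul_le_mul_of_nonneg_right hm1 hnn]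

end SetEqProtocol

theorem theorem3 :
    -- `|U| < ℓ`
    (∃ c : ℝ, 0 < c ∧ ∀ (r ℓ : ℕ) (U : Type*) [Fintype U] (P : SetEqProtocol r ℓ U),
      3 ≤ r → 2 ≤ Fintype.card U → Fintype.card U < ℓ →
      P.Solves (SetEquality ℓ U) (3 / 4) (1 / 4) →
      c * ((Fintype.card U : ℝ) * Real.logb 2 ((ℓ : ℝ) / (Fintype.card U : ℝ)))
        ≤ (P.certSize : ℝ)) ∧
    -- `|U| = Ω(ℓ)`
    (∀ κ : ℝ, 0 < κ → ∃ c : ℝ, 0 < c ∧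
      ∀ (r ℓ : ℕ) (U : Type*) [Fintype U] (P : SetEqProtocol r ℓ U),
      3 ≤ r → 1 ≤ ℓ → 2 ≤ Fintype.card U → κ * (ℓ : ℝ) ≤ (Fintype.card U : ℝ) →
      P.Solves (SetEquality ℓ U) (3 / 4) (1 / 4) →
      c * (ℓ : ℝ) ≤ (P.certSize : ℝ)) ∧
    -- `|U| = Ω(r ℓ)`
    (∀ κ : ℝ, 0 < κ → ∃ c : ℝ, 0 < c ∧
      ∀ (r ℓ : ℕ) (U : Type*) [Fintype U] (P : SetEqProtocol r ℓ U),
      3 ≤ r → 1 ≤ ℓ → 2 ≤ Fintype.card U → κ * ((r : ℝ) * (ℓ : ℝ)) ≤ (Fintype.card U : ℝ) →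
      P.Solves (SetEquality ℓ U) (3 / 4) (1 / 4) →
      c * ((r : ℝ) * (ℓ : ℝ)) ≤ (P.certSize : ℝ)) := by
  refine ⟨⟨1 / 4, by norm_num, ?_⟩, fun κ hκ => ⟨min (1 / 8) (κ / 4), by positivity, ?_⟩,
    fun κ hκ => ⟨min (1 / 8) (κ / 4), by positivity, ?_⟩⟩
  · intro r ℓ U _ P hr hU hUℓ hP
    exact P.card_mul_logb_le_certSize hr hU hUℓ hP
  · intro r ℓ U _ P hr _ hU hκU hP
    refine P.mul_le_certSize hU hP (k := 1) (by omega) (by positivity) ?_ hκU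
    push_cast
    linarith [Nat.cast_nonneg (α := ℝ) ℓ]
  · intro r ℓ U _ P hr _ hU hκU hP
    -- The largest `k` for which both blocks fit; `r ≤ 4 * k` holds for `r ≥ 3`, with equality at `r
    -- = 4`.
    refine P.mul_le_certSize hU hP (k := (r - 1) / 2) (by omega) (by positivity) ?_ hκU
    have h : r * ℓ ≤ 4 * ((r - 1) / 2 * ℓ) := by
      rw [← mul_assoc]
      exact Nat.mul_le_mul_right ℓ (by omega)
    exact_mod_cast h
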